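/- Theorem 1. Fix an integer $N\ge 1$ (the dimension) and a finite alphabet $\mathbb S=\{s^{(0)},\dots,s^{(L-1)}\}\subset\mathbb R$. For every $K\ge 1$ let vectors $g_{1},\dots,g_{2K}\in\mathbb R^{N}$, an index $k\in\{1,\dots,2K\}$, a known real number $s_k$, a noise variance $\sigma_z^2>0$, positive prior probabilities $p_{\mathrm{pr},k'}(s^{(\ell)})$ ($0\le \ell\le L-1$, with sum $1$ over $\ell$) and parameters $\theta_{k'}=(\theta_{k',1},\dots,\theta_{k',L-1})\in\mathbb R^{L-1}$ be given for $k'=1,\dots,2K$ (all of them may depend on $K$). Put $d_{k',\ell}=\ln\big(p_{\mathrm{pr},k'}(s^{(\ell)})/p_{\mathrm{pr},k'}(s^{(0)})\big)$ and let $p_{0,k'}(\cdot\,;\theta_{k'})$ be the probability distribution on $\mathbb S$ given by $$p_{0,k'}(s^{(j)};\theta_{k'})=\exp\Big\{\sum_{\ell=1}^{L-1}(d_{k',\ell}+\theta_{k',\ell})\,\delta_{j\ell}-\psi_0(\theta_{k'})\Big\},\qquad \psi_0(\theta_{k'})=\ln\Big(1+\sum_{\ell=1}^{L-1}e^{d_{k',\ell}+\theta_{k',\ell}}\Big),$$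 with mean $\mu_{k'}$. Let $s_{k'}$, $k'\ne k$, be independent random variables with laws $p_{0,k'}(\cdot\,;\theta_{k'})$, let $w'\sim\mathcal N(g_k s_k,\sigma_z^2 I)$ be independent of $(s_{k'})_{k'\neq k}$, and let $$\bar y=\sum_{k'\ne k} g_{k'}s_{k'}+w'\in\mathbb R^{N},$$ with mean vector $\mathbb E\{\bar y\}$ and covariance matrix $\mathbb V\{\bar y\}$. Suppose that $$\lim_{K\to\infty}\Big(\sum_{k'\ne k}\mathbb E\big\|\mathbb V\{\bar y\}^{-1/2}g_{k'}(s_{k'}-\mu_{k'})\big\|^3+\mathbb E\big\|\mathbb V\{\bar y\}^{-1/2}(w'-g_ks_k)\big\|^3\Big)=0 .$$ Then, as $K\to\infty$, $\bar y$ converges in distribution to a Gaussian vector $\tilde y\sim\mathcal N(\mathbb E\{\bar y\},\mathbb V\{\bar y\})$ with the same mean and covariance. As this target depends on $K$, the claim means that both of the following hold: (i) $\mathbb V\{\bar y\}^{-1/2}(\bar y-\mathbb E\{\bar y\})$ converges in distribution to $\mathcal N(0,I)$; (ii) $\sup_{z\in\mathbb R^{N}}\big|\Pr(\bar y\le z)-\Pr(\tilde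 y\le z)\big|\to 0$, where $\le$ is componentwise. -/

import Mathlib

open MeasureTheory ProbabilityTheory Filter Topology
open scoped MatrixOrder

noncomputable section

namespace HybridCLT

/-! ### The law of one discrete symbol

The alphabet has `m + 1` points `a 0, …, a m`. The prior gives the point `a ℓ` the positive
probability `q ℓ`, and `θ 1, …, θ m` are the coordinates of the exponential family through `q`. -/

/-- The natural parameters `d_ℓ = log (q_ℓ / q_0)`, `1 ≤ ℓ ≤ m`, of the prior `q`. -/
def priorParam {m : ℕ} (q : Fin (m + 1) → ℝ) (ℓ : Fin m) : ℝ :=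
  Real.log (q ℓ.succ / q 0)

/-- The free energy `ψ₀(θ) = log (1 + ∑ exp (d_ℓ + θ_ℓ))`. -/
def freeEnergy {m : ℕ} (q : Fin (m + 1) → ℝ) (θ : Fin m → ℝ) : ℝ :=
  Real.log (1 + ∑ ℓ, Real.exp (priorParam q ℓ + θ ℓ))

/-- The probability `p₀(a_j; θ) = exp (∑_ℓ (d_ℓ + θ_ℓ) δ_{j,ℓ} - ψ₀(θ))` of the `j`-th point. -/
def symbolProb {m : ℕ} (q : Fin (m + 1) → ℝ) (θ : Fin m → ℝ) (j : Fin (m + 1)) : ℝ :=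
  Real.exp ((∑ ℓ, (priorParam q ℓ + θ ℓ) * (if j = ℓ.succ then 1 else 0)) - freeEnergy q θ)

/-- The law `p₀(·; θ)` of a symbol, as a measure on the real line. -/
def symbolLaw {m : ℕ} (a : Fin (m + 1) → ℝ) (q : Fin (m + 1) → ℝ) (θ : Fin m → ℝ) : Measure ℝ :=
  ∑ j, ENNReal.ofReal (symbolProb q θ j) • Measure.dirac (a j)

/-- The mean of a symbol with law `p₀(·; θ)`. -/
def symbolMean {m : ℕ} (a : Fin (m + 1) → ℝ) (q : Fin (m + 1) → ℝ) (θ : Fin m → ℝ) : ℝ :=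
  ∑ j, a j * symbolProb q θ j

/-! ### Random vectors -/

/-- The covariance matrix of a random vector. -/
def covMatrix {N : ℕ} {Ω : Type*} [MeasurableSpace Ω] (Y : Ω → EuclideanSpace ℝ (Fin N))
    (P : Measure Ω) : Matrix (Fin N) (Fin N) ℝ :=
  Matrix.of fun i j => cov[fun ω => Y ω i, fun ω => Y ω j; P]

/-- `V^{-1/2} x`, for a positive definite matrix `V`. -/
def whiten {N : ℕ} (V : Matrix (Fin N) (Fin N) ℝ) (x : EuclideanSpace ℝ (Fin N)) :
    EuclideanSpace ℝ (Fin N) :=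
  Matrix.toEuclideanCLM (𝕜 := ℝ) (CFC.sqrt V)⁻¹ x

/-- The lower orthant `{y | y_i ≤ x_i for all i}`; the probability of these sets is the joint
cumulative distribution function. -/
def lowerOrthant {N : ℕ} (x : EuclideanSpace ℝ (Fin N)) : Set (EuclideanSpace ℝ (Fin N)) :=
  {y | ∀ i, y i ≤ x i}

/-- The `k`-th column of `G`, as a vector of the Euclidean space. -/
def column {N n : ℕ} (G : Matrix (Fin N) (Fin n) ℝ) (k : Fin n) : EuclideanSpace ℝ (Fin N) :=
  WithLp.toLp 2 fun i => G i k

/-- The hybrid random vector `∑_{k' ≠ k} s_{k'} g_{k'} + w'`. -/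
def hybridVector {N n : ℕ} {Ω : Type*} (G : Matrix (Fin N) (Fin n) ℝ) (k : Fin n)
    (S : {k' : Fin n // k' ≠ k} → Ω → ℝ) (W : Ω → EuclideanSpace ℝ (Fin N)) (ω : Ω) :
    EuclideanSpace ℝ (Fin N) :=
  (∑ k', S k' ω • column G k'.1) + W ω

/-- The sum of the whitened third absolute moments of the independent summands of the hybrid
random vector: `S k'` is a symbol with mean `μ k'`, and the Gaussian summand `W` has mean
`x • column G k`. -/
def thirdMomentSum {N n : ℕ} {Ω : Type*} [MeasurableSpace Ω] (P : Measure Ω)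
    (G : Matrix (Fin N) (Fin n) ℝ) (k : Fin n) (x : ℝ) (μ : Fin n → ℝ)
    (S : {k' : Fin n // k' ≠ k} → Ω → ℝ) (W : Ω → EuclideanSpace ℝ (Fin N)) : ℝ :=
  let V := covMatrix (hybridVector G k S W) P
  (∑ k', ∫ ω, ‖whiten V ((S k' ω - μ k'.1) • column G k'.1)‖ ^ 3 ∂P)
    + ∫ ω, ‖whiten V (W ω - x • column G k)‖ ^ 3 ∂P

end HybridCLT

end

namespace HybridCLT

/-! ### A quantitative Lyapunov theorem for characteristic functions -/

/-! Write `Y` for the hybrid vector, with mean `E` and covariance `V`. The nondegenerate noise makes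
`V` positive definite, so whitening is invertible for every `K`. For fixed `t`, put `u = V^{-1/2}
t`. Then `⟪V^{-1/2}(Y - E), t⟫ = ⟪u, Y - E⟫` is a sum of independent centred real variables with
total variance `u ⬝ᵥ V u = ‖t‖ ^ 2`. Lyapunov's argument replaces each characteristic function by a
Gaussian one, at a cost bounded by third absolute moments. The total error is at most `5 * ‖t‖ ^ 3`
times the third-moment sum (`norm_charFun_whiten_sub_le`), and Lévy's continuity theorem gives (i).

For (ii), whitening turns a lower orthant into an intersection of `N` half-spaces with unit normals,
which vary with `K` and `z`. Convergence must therefore be uniform over such polyhedra. Weak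
convergence makes the Lévy–Prokhorov distance to the standard Gaussian tend to zero. Thickening a
polyhedron by `δ` moves each face by at most `δ`, and the Gaussian mass gained is at most `N * δ`.
The resulting bound `(N + 1) * δ` involves neither `K` nor `z`. -/

lemma norm_exp_mul_I_sub_taylor_le (x : ℝ) :
    ‖Complex.exp (x * Complex.I) - (1 + x * Complex.I - (x : ℂ) ^ 2 / 2)‖ ≤ 4 * |x| ^ 3 := by
  have hn : ‖(x : ℂ) * Complex.I‖ = |x| := by simp
  -- For `|x| ≤ 1` this is the Taylor remainder. For `|x| ≥ 1` every term is dominated by `|x| ^ 3`,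
  -- and the sum `1 + 1 + 1 + 1/2` accounts for the constant 4.
  rcases le_total |x| 1 with h | h
  · have := Complex.exp_bound (x := (x : ℂ) * Complex.I) (by rwa [hn]) (n := 3) (by norm_num)
    rw [hn] at this
    have h2 : ∑ m ∈ Finset.range 3, ((x : ℂ) * Complex.I) ^ m / m.factorial
        = 1 + x * Complex.I - (x : ℂ) ^ 2 / 2 := by
      simp [Finset.sum_range_succ, mul_pow, Nat.factorial]
      ring
    rw [h2] at this
    refine this.trans ?_
    have h3 : 0 ≤ |x| ^ 3 := by positivity
    norm_num [Nat.factorial]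
    linarith
  · have h1 : ‖Complex.exp (x * Complex.I)‖ = 1 := Complex.norm_exp_ofReal_mul_I x
    have h2 : ‖(x : ℂ) ^ 2 / 2‖ = |x| ^ 2 / 2 := by simp
    have h3 : ‖(1 : ℂ) + x * Complex.I - (x : ℂ) ^ 2 / 2‖ ≤ 1 + |x| + |x| ^ 2 / 2 := by
      refine (norm_sub_le _ _).trans ?_
      rw [h2]
      gcongr
      refine (norm_add_le _ _).trans ?_
      rw [hn, norm_one]
    refine (norm_sub_le _ _).trans ?_
    rw [h1]
    have h4 : |x| ≤ |x| ^ 3 := le_self_pow₀ h (by norm_num)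
    have h5 : |x| ^ 2 ≤ |x| ^ 3 := pow_le_pow_right₀ h (by norm_num)
    linarith

lemma abs_exp_neg_sq_div_two_sub_le {s : ℝ} (hs : 0 ≤ s) :
    |Real.exp (-s ^ 2 / 2) - (1 - s ^ 2 / 2)| ≤ s ^ 3 := by
  rcases le_total s 1 with h | h
  · have h1 : |-s ^ 2 / 2| ≤ 1 := by
      rw [abs_le]; constructor <;> nlinarith
    have := Real.abs_exp_sub_one_sub_id_le h1
    have h2 : Real.exp (-s ^ 2 / 2) - (1 - s ^ 2 / 2)
        = Real.exp (-s ^ 2 / 2) - 1 - -s ^ 2 / 2 := by ring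
    rw [h2]
    refine this.trans ?_
    have h3 : s ^ 4 ≤ s ^ 3 := pow_le_pow_of_le_one hs h (by norm_num)
    have h4 : 0 ≤ s ^ 3 := by positivity
    nlinarith
  · have h1 : Real.exp (-s ^ 2 / 2) ≤ 1 := Real.exp_le_one_iff.2 (by nlinarith)
    have h2 := Real.add_one_le_exp (-s ^ 2 / 2)
    have h3 : s ^ 2 ≤ s ^ 3 := pow_le_pow_right₀ h (by norm_num)
    rw [abs_le]
    constructor <;> nlinarith

/-- Telescoping: factors are exchanged one at a time, and all the others lie in the unit disc. -/
lemma norm_prod_sub_prod_le {ι : Type*} (s : Finset ι) (u v : ι → ℂ)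
    (hu : ∀ i ∈ s, ‖u i‖ ≤ 1) (hv : ∀ i ∈ s, ‖v i‖ ≤ 1) :
    ‖∏ i ∈ s, u i - ∏ i ∈ s, v i‖ ≤ ∑ i ∈ s, ‖u i - v i‖ := by
  classical
  induction s using Finset.induction with
  | empty => simp
  | insert i s hi ih =>
    rw [Finset.prod_insert hi, Finset.prod_insert hi, Finset.sum_insert hi]
    have hs := ih (fun j hj => hu j (Finset.mem_insert_of_mem hj))
      (fun j hj => hv j (Finset.mem_insert_of_mem hj))
    have hp : ‖∏ j ∈ s, u j‖ ≤ 1 := by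
      rw [norm_prod]
      exact Finset.prod_le_one (fun _ _ => norm_nonneg _)
        (fun j hj => hu j (Finset.mem_insert_of_mem hj))
    have hi' := hv i (Finset.mem_insert_self i s)
    calc ‖u i * ∏ j ∈ s, u j - v i * ∏ j ∈ s, v j‖
        = ‖(u i - v i) * ∏ j ∈ s, u j + v i * (∏ j ∈ s, u j - ∏ j ∈ s, v j)‖ := by
          congr 1; ring
      _ ≤ ‖u i - v i‖ * ‖∏ j ∈ s, u j‖ + ‖v i‖ * ‖∏ j ∈ s, u j - ∏ j ∈ s, v j‖ := by
          refine (norm_add_le _ _).trans ?_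
          rw [norm_mul, norm_mul]
      _ ≤ ‖u i - v i‖ * 1 + 1 * ∑ j ∈ s, ‖u j - v j‖ := by gcongr
      _ = _ := by ring

section

variable {Ω : Type*} [MeasurableSpace Ω] {P : Measure Ω}

lemma integrable_abs_pow_three {X : Ω → ℝ} (hX : MemLp X 3 P) :
    Integrable (fun ω => |X ω| ^ 3) P := by
  have := hX.integrable_norm_pow (p := 3) (by norm_num)
  simpa using this

variable [IsProbabilityMeasure P]

lemma sqrt_integral_sq_pow_three_le {X : Ω → ℝ} (hX : MemLp X 3 P) :
    √(∫ ω, X ω ^ 2 ∂P) ^ 3 ≤ ∫ ω, |X ω| ^ 3 ∂P := by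
  set s := √(∫ ω, X ω ^ 2 ∂P) with hs
  have hs0 : 0 ≤ s := Real.sqrt_nonneg _
  have hsq : s ^ 2 = ∫ ω, X ω ^ 2 ∂P := Real.sq_sqrt (integral_nonneg fun _ => sq_nonneg _)
  have h2 : Integrable (fun ω => X ω ^ 2) P :=
    (hX.mono_exponent (by norm_num)).integrable_sq
  -- The integrand on the left is the tangent line of the convex function `v ↦ v ^ (3/2)` at `v = s
  -- ^ 2`, taken at `v = X ω ^ 2`. With `y = |X ω|`, the gap is `(y - s) ^ 2 * (y + s / 2)`.
  have key : ∫ ω, (3 / 2 * s * X ω ^ 2 - s ^ 3 / 2) ∂P ≤ ∫ ω, |X ω| ^ 3 ∂P := by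
    refine integral_mono ((h2.const_mul _).sub (integrable_const _))
      (integrable_abs_pow_three hX) fun ω => ?_
    have h := abs_nonneg (X ω)
    show 3 / 2 * s * X ω ^ 2 - s ^ 3 / 2 ≤ |X ω| ^ 3
    rw [← sq_abs (X ω)]
    nlinarith [mul_nonneg h (sq_nonneg (|X ω| - s)), mul_nonneg hs0 (sq_nonneg (|X ω| - s))]
  rw [integral_sub (h2.const_mul _) (integrable_const _), integral_const_mul, ← hsq] at key
  simp at key
  nlinarith

/-- Both terms share the second-order expansion `1 - s ^ 2 / 2`, with `s` the standard deviation.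
The two remainders contribute 4 and 1 to the constant. Evaluation at `1` loses nothing, since the
frequency can be absorbed into `X`. -/
lemma norm_charFun_one_sub_exp_le {X : Ω → ℝ} (hX : MemLp X 3 P) (h0 : ∫ ω, X ω ∂P = 0) :
    ‖charFun (P.map X) 1 - Complex.exp (-(Var[X; P] : ℂ) / 2)‖ ≤ 5 * ∫ ω, |X ω| ^ 3 ∂P := by
  have hm : AEMeasurable X P := hX.aestronglyMeasurable.aemeasurable
  have h1 : Integrable X P := hX.integrable (by norm_num)
  have h2 : Integrable (fun ω => X ω ^ 2) P :=
    (hX.mono_exponent (by norm_num)).integrable_sq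
  have hvar : Var[X; P] = ∫ ω, X ω ^ 2 ∂P := by
    simpa using variance_of_integral_eq_zero hm h0
  set s := √(∫ ω, X ω ^ 2 ∂P) with hs
  have hsq : s ^ 2 = ∫ ω, X ω ^ 2 ∂P := Real.sq_sqrt (integral_nonneg fun _ => sq_nonneg _)
  have hexp : Integrable (fun ω => Complex.exp (X ω * Complex.I)) P := by
    refine Integrable.of_bound (C := 1) ?_ (ae_of_all _ fun ω => ?_)
    · exact (Complex.measurable_exp.comp_aemeasurable
        ((Complex.measurable_ofReal.comp_aemeasurable hm).mul_const _)).aestronglyMeasurable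
    · rw [Complex.norm_exp_ofReal_mul_I]
  have h1c : Integrable (fun ω => (X ω : ℂ) * Complex.I) P := h1.ofReal.mul_const _
  have h2c : Integrable (fun ω => (X ω : ℂ) ^ 2 / 2) P := by
    simpa using! (h2.ofReal (𝕜 := ℂ)).div_const 2
  have hpoly : Integrable (fun ω => 1 + (X ω : ℂ) * Complex.I - (X ω : ℂ) ^ 2 / 2) P :=
    ((integrable_const _).add h1c).sub h2c
  have hcf : charFun (P.map X) 1 = ∫ ω, Complex.exp (X ω * Complex.I) ∂P := by
    rw [charFun_apply_real, integral_map hm (by fun_prop)]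
    simp
  have htay : ∫ ω, (1 + (X ω : ℂ) * Complex.I - (X ω : ℂ) ^ 2 / 2) ∂P
      = ((1 - s ^ 2 / 2 : ℝ) : ℂ) := by
    have h1d : Integrable (fun ω => 1 + (X ω : ℂ) * Complex.I) P := (integrable_const _).add h1c
    rw [integral_sub h1d h2c, integral_add (integrable_const _) h1c, integral_mul_const, integral_div, hsq]
    have e1 : ∫ ω, (X ω : ℂ) ∂P = 0 := by
      rw [integral_complex_ofReal, h0]; simp
    have e2 : ∫ ω, (X ω : ℂ) ^ 2 ∂P = ((∫ ω, X ω ^ 2 ∂P : ℝ) : ℂ) := by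
      rw [← integral_complex_ofReal]; simp
    rw [e1, e2]
    simp
  have ha : ‖charFun (P.map X) 1 - ((1 - s ^ 2 / 2 : ℝ) : ℂ)‖ ≤ 4 * ∫ ω, |X ω| ^ 3 ∂P := by
    rw [hcf, ← htay, ← integral_sub hexp hpoly, ← integral_const_mul]
    exact norm_integral_le_of_norm_le ((integrable_abs_pow_three hX).const_mul _)
      (ae_of_all _ fun ω => norm_exp_mul_I_sub_taylor_le (X ω))
  have hb : ‖((1 - s ^ 2 / 2 : ℝ) : ℂ) - Complex.exp (-(Var[X; P] : ℂ) / 2)‖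
      ≤ ∫ ω, |X ω| ^ 3 ∂P := by
    have : Complex.exp (-(Var[X; P] : ℂ) / 2) = ((Real.exp (-s ^ 2 / 2) : ℝ) : ℂ) := by
      rw [hvar, ← hsq]; push_cast; rfl
    rw [this, ← Complex.ofReal_sub, Complex.norm_real, Real.norm_eq_abs, abs_sub_comm]
    exact (abs_exp_neg_sq_div_two_sub_le (Real.sqrt_nonneg _)).trans
      (sqrt_integral_sq_pow_three_le hX)
  calc _ ≤ _ := norm_sub_le_norm_sub_add_norm_sub _ ((1 - s ^ 2 / 2 : ℝ) : ℂ) _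
    _ ≤ _ := add_le_add ha hb
    _ = _ := by ring

/-- **Lyapunov's theorem**, quantitative form at the level of characteristic functions. -/
lemma norm_charFun_sum_sub_exp_le {ι : Type*} [Fintype ι] {X : ι → Ω → ℝ}
    (hX : ∀ i, MemLp (X i) 3 P) (h0 : ∀ i, ∫ ω, X i ω ∂P = 0) (hind : iIndepFun X P) :
    ‖charFun (P.map fun ω => ∑ i, X i ω) 1 - Complex.exp (-((∑ i, Var[X i; P] : ℝ) : ℂ) / 2)‖
      ≤ 5 * ∑ i, ∫ ω, |X i ω| ^ 3 ∂P := by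
  have hm : ∀ i, AEMeasurable (X i) P := fun i => (hX i).aestronglyMeasurable.aemeasurable
  have he : Complex.exp (-((∑ i, Var[X i; P] : ℝ) : ℂ) / 2)
      = ∏ i, Complex.exp (-(Var[X i; P] : ℂ) / 2) := by
    rw [← Complex.exp_sum, ← Finset.sum_div, Finset.sum_neg_distrib]
    push_cast; rfl
  rw [hind.charFun_map_fun_sum_eq_prod hm, he, Finset.prod_apply, Finset.mul_sum]
  refine (norm_prod_sub_prod_le _ _ _ (fun i _ => ?_) (fun i _ => ?_)).trans
    (Finset.sum_le_sum fun i _ => norm_charFun_one_sub_exp_le (hX i) (h0 i))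
  · have := Measure.isProbabilityMeasure_map (hm i)
    exact norm_charFun_le_one _
  · have : -(Var[X i; P] : ℂ) / 2 = ((-Var[X i; P] / 2 : ℝ) : ℂ) := by push_cast; rfl
    rw [this, Complex.norm_exp_ofReal]
    exact Real.exp_le_one_iff.2 (by linarith [variance_nonneg (X i) P])

/-- The Lyapunov bound with one more summand, independent of the family of the others. -/
lemma norm_charFun_sum_add_sub_exp_le {ι : Type*} [Fintype ι] {X : ι → Ω → ℝ} {Z : Ω → ℝ}
    (hX : ∀ i, MemLp (X i) 3 P) (h0 : ∀ i, ∫ ω, X i ω ∂P = 0) (hind : iIndepFun X P)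
    (hZ : MemLp Z 3 P) (hZ0 : ∫ ω, Z ω ∂P = 0)
    (hXZ : IndepFun (fun ω => ∑ i, X i ω) Z P) :
    ‖charFun (P.map fun ω => ∑ i, X i ω + Z ω) 1
        - Complex.exp (-((Var[fun ω => ∑ i, X i ω + Z ω; P] : ℝ) : ℂ) / 2)‖
      ≤ 5 * (∑ i, ∫ ω, |X i ω| ^ 3 ∂P + ∫ ω, |Z ω| ^ 3 ∂P) := by
  have hle : (2 : ENNReal) ≤ 3 := by norm_num
  have hm : AEMeasurable (fun ω => ∑ i, X i ω) P :=
    Finset.aemeasurable_fun_sum _ fun i _ => (hX i).aestronglyMeasurable.aemeasurable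
  have hZm : AEMeasurable Z P := hZ.aestronglyMeasurable.aemeasurable
  have hvs : Var[fun ω => ∑ i, X i ω; P] = ∑ i, Var[X i; P] := by
    have := IndepFun.variance_sum (μ := P) (X := X) (s := Finset.univ)
      (fun i _ => (hX i).mono_exponent hle) (fun i _ j _ hij => hind.indepFun hij)
    rw [← this]; congr 1; ext; simp
  have hv : Var[fun ω => ∑ i, X i ω + Z ω; P] = ∑ i, Var[X i; P] + Var[Z; P] := by
    rw [hXZ.variance_fun_add (memLp_finsetSum _ fun i _ => (hX i).mono_exponent hle)
      (hZ.mono_exponent hle), hvs]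
  rw [hXZ.charFun_map_fun_add_eq_mul hm hZm, hv, Pi.mul_apply]
  have h1 := norm_charFun_sum_sub_exp_le hX h0 hind
  have h2 := norm_charFun_one_sub_exp_le hZ hZ0
  have he : Complex.exp (-((∑ i, Var[X i; P] + Var[Z; P] : ℝ) : ℂ) / 2)
      = Complex.exp (-((∑ i, Var[X i; P] : ℝ) : ℂ) / 2) * Complex.exp (-(Var[Z; P] : ℂ) / 2) := by
    rw [← Complex.exp_add]; congr 1; push_cast; ring
  rw [he]
  have hu : ‖charFun (P.map Z) 1‖ ≤ 1 := by
    have := Measure.isProbabilityMeasure_map hZm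
    exact norm_charFun_le_one _
  have hw : ‖Complex.exp (-((∑ i, Var[X i; P] : ℝ) : ℂ) / 2)‖ ≤ 1 := by
    have : -((∑ i, Var[X i; P] : ℝ) : ℂ) / 2 = ((-(∑ i, Var[X i; P]) / 2 : ℝ) : ℂ) := by
      push_cast; rfl
    rw [this, Complex.norm_exp_ofReal]
    have := Finset.sum_nonneg fun i (_ : i ∈ Finset.univ) => variance_nonneg (X i) P
    exact Real.exp_le_one_iff.2 (by linarith)
  generalize charFun (P.map fun ω => ∑ i, X i ω) 1 = A at *
  generalize charFun (P.map Z) 1 = B at *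
  generalize Complex.exp (-((∑ i, Var[X i; P] : ℝ) : ℂ) / 2) = C at *
  generalize Complex.exp (-(Var[Z; P] : ℂ) / 2) = D at *
  -- The two-factor telescoping, with `B` and `C` in the unit disc.
  calc ‖A * B - C * D‖ = ‖(A - C) * B + C * (B - D)‖ := by congr 1; ring
    _ ≤ ‖A - C‖ * ‖B‖ + ‖C‖ * ‖B - D‖ := by
        refine (norm_add_le _ _).trans ?_
        rw [norm_mul, norm_mul]
    _ ≤ ‖A - C‖ * 1 + 1 * ‖B - D‖ := by gcongr
    _ ≤ _ := by linarith

end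

/-! ### Weak convergence to a Gaussian is uniform on polyhedra with a fixed number of faces -/

/-- The polyhedron `{u | ⟪b i, u⟫ ≤ c i for all i}`. -/
def polyhedron {E ι : Type*} [NormedAddCommGroup E] [InnerProductSpace ℝ E] (b : ι → E)
    (c : ι → ℝ) : Set E :=
  {u | ∀ i, inner ℝ (b i) u ≤ c i}

section

variable {E : Type*} [NormedAddCommGroup E] [InnerProductSpace ℝ E]

lemma thickening_polyhedron_subset {ι : Type*} (b : ι → E) (hb : ∀ i, ‖b i‖ = 1) (c : ι → ℝ)
    (δ : ℝ) : Metric.thickening δ (polyhedron b c) ⊆ polyhedron b fun i => c i + δ := by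
  intro u hu i
  obtain ⟨v, hv, huv⟩ := Metric.mem_thickening_iff.1 hu
  have h1 : inner ℝ (b i) u = inner ℝ (b i) v + inner ℝ (b i) (u - v) := by
    rw [← inner_add_right]; congr 1; abel
  have h2 : inner ℝ (b i) (u - v) ≤ ‖b i‖ * ‖u - v‖ := real_inner_le_norm _ _
  rw [hb, one_mul, ← dist_eq_norm] at h2
  have h3 := hv i
  linarith

variable [MeasurableSpace E] [BorelSpace E]

lemma measurableSet_polyhedron {ι : Type*} (b : ι → E) (c : ι → ℝ) :
    MeasurableSet (polyhedron b c) := by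
  refine IsClosed.measurableSet ?_
  simp only [polyhedron, Set.ofPred_forall]
  exact isClosed_iInter fun i => isClosed_le (by fun_prop) (by fun_prop)

/-- The standard normal density is at most `1 / √(2π) ≤ 1`. -/
lemma gaussianReal_Ioc_le (c δ : ℝ) (hδ : 0 ≤ δ) :
    (gaussianReal 0 1).real (Set.Ioc c (c + δ)) ≤ δ := by
  have hpdf : ∀ x, gaussianPDF 0 1 x ≤ 1 := fun x => by
    rw [gaussianPDF, ← ENNReal.ofReal_one]
    refine ENNReal.ofReal_le_ofReal ?_
    rw [gaussianPDFReal]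
    have h1 : (√(2 * Real.pi * (1 : NNReal)))⁻¹ ≤ 1 := by
      refine inv_le_one_of_one_le₀ (Real.one_le_sqrt.2 ?_)
      have := Real.pi_gt_three
      simp
      linarith
    have h2 : Real.exp (-(x - 0) ^ 2 / (2 * (1 : NNReal))) ≤ 1 :=
      Real.exp_le_one_iff.2 (by
        rw [neg_div, neg_nonpos]; positivity)
    exact mul_le_one₀ h1 (Real.exp_pos _).le h2
  have h : gaussianReal 0 1 (Set.Ioc c (c + δ)) ≤ ENNReal.ofReal δ := by
    rw [gaussianReal_apply _ one_ne_zero]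
    refine (lintegral_mono hpdf).trans ?_
    simp
  exact ENNReal.toReal_le_of_le_ofReal hδ h

variable [FiniteDimensional ℝ E]

lemma stdGaussian_map_inner {b : E} (hb : ‖b‖ = 1) :
    (stdGaussian E).map (fun u => inner ℝ b u) = gaussianReal 0 1 := by
  have h := IsGaussian.map_eq_gaussianReal (μ := stdGaussian E) (innerSL ℝ b)
  rw [variance_dual_stdGaussian, integral_strongDual_stdGaussian, innerSL_apply_norm, hb] at h
  simpa using! h

/-- A point gained by relaxing the constraints lies in one of the slabs of width `δ` along the
faces. Unit normals have standard normal marginals, so each slab has mass at most `δ`, wherever the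
face is. -/
lemma stdGaussian_polyhedron_add_le {ι : Type*} [Fintype ι] (b : ι → E) (hb : ∀ i, ‖b i‖ = 1)
    (c : ι → ℝ) {δ : ℝ} (hδ : 0 ≤ δ) :
    (stdGaussian E).real (polyhedron b fun i => c i + δ)
      ≤ (stdGaussian E).real (polyhedron b c) + Fintype.card ι * δ := by
  have hsub : (polyhedron b fun i => c i + δ) ⊆
      polyhedron b c ∪ ⋃ i, (fun u => inner ℝ (b i) u) ⁻¹' Set.Ioc (c i) (c i + δ) := by
    intro u hu
    by_cases h : u ∈ polyhedron b c
    · exact Or.inl h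
    · simp only [polyhedron, Set.mem_ofPred_eq, not_forall, not_le] at h
      obtain ⟨i, hi⟩ := h
      exact Or.inr (Set.mem_iUnion.2 ⟨i, hi, hu i⟩)
  refine (measureReal_mono hsub).trans ((measureReal_union_le _ _).trans ?_)
  gcongr
  refine (measureReal_iUnion_fintype_le _).trans ?_
  calc ∑ i, (stdGaussian E).real ((fun u => inner ℝ (b i) u) ⁻¹' Set.Ioc (c i) (c i + δ))
      ≤ ∑ _i : ι, δ := Finset.sum_le_sum fun i _ => by
        rw [← map_measureReal_apply (by fun_prop) measurableSet_Ioc, stdGaussian_map_inner (hb i)]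
        exact gaussianReal_Ioc_le _ _ hδ
    _ = _ := by simp

lemma abs_sub_stdGaussian_polyhedron_le {ι : Type*} [Fintype ι] {ν : Measure E}
    [IsProbabilityMeasure ν] {δ : ℝ} (hδ : 0 ≤ δ)
    (h : levyProkhorovEDist ν (stdGaussian E) < ENNReal.ofReal δ)
    (b : ι → E) (hb : ∀ i, ‖b i‖ = 1) (c : ι → ℝ) :
    |ν.real (polyhedron b c) - (stdGaussian E).real (polyhedron b c)|
      ≤ (Fintype.card ι + 1) * δ := by
  have key : ∀ (μ₁ μ₂ : Measure E) [IsProbabilityMeasure μ₁] [IsProbabilityMeasure μ₂]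
      (A B : Set E), μ₁ A ≤ μ₂ (Metric.thickening (ENNReal.ofReal δ).toReal A) + ENNReal.ofReal δ →
      Metric.thickening δ A ⊆ B → μ₁.real A ≤ μ₂.real B + δ := by
    intro μ₁ μ₂ _ _ A B h1 h2
    rw [ENNReal.toReal_ofReal hδ] at h1
    have h3 := h1.trans (add_le_add_left (measure_mono h2) _)
    have h4 := ENNReal.toReal_mono (by finiteness) h3
    rwa [ENNReal.toReal_add (by finiteness) (by finiteness), ENNReal.toReal_ofReal hδ] at h4
  have upper := key ν (stdGaussian E) _ _
    (left_measure_le_of_levyProkhorovEDist_lt h (measurableSet_polyhedron b c))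
    (thickening_polyhedron_subset b hb c δ)
  -- The lower bound starts from the polyhedron shrunk by `δ`, whose thickening stays inside the
  -- original one.
  have hsub := thickening_polyhedron_subset b hb (fun i => c i - δ) δ
  have lower := key (stdGaussian E) ν _ _
    (right_measure_le_of_levyProkhorovEDist_lt h (measurableSet_polyhedron b fun i => c i - δ))
    hsub
  have g1 := stdGaussian_polyhedron_add_le b hb c hδ
  have g2 := stdGaussian_polyhedron_add_le b hb (fun i => c i - δ) hδ
  simp only [sub_add_cancel] at lower g2
  rw [abs_le]
  constructor <;> linarith

lemma tendsto_levyProkhorovEDist {α : Type*} {l : Filter α} {ν : α → ProbabilityMeasure E}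
    {γ : ProbabilityMeasure E} (h : Tendsto ν l (𝓝 γ)) :
    Tendsto (fun a => levyProkhorovEDist (ν a : Measure E) (γ : Measure E)) l (𝓝 0) := by
  have h1 := (LevyProkhorov.continuous_ofMeasure_probabilityMeasure (Ω := E)).continuousAt
    (x := γ) |>.tendsto.comp h
  rw [tendsto_iff_edist_tendsto_0] at h1
  simpa [LevyProkhorov.edist_probabilityMeasure_def] using! h1

end

/-! ### Moments of the symbols and of the noise -/

section

variable {Ω : Type*} [MeasurableSpace Ω] {P : Measure Ω}

lemma memLp_of_hasLaw_symbolLaw [IsFiniteMeasure P] {m : ℕ} {a q : Fin (m + 1) → ℝ}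
    {θ : Fin m → ℝ} {X : Ω → ℝ} (hX : HasLaw X (symbolLaw a q θ) P) (p : ENNReal) :
    MemLp X p P := by
  refine MemLp.of_bound hX.aemeasurable.aestronglyMeasurable (∑ j, |a j|) ?_
  have hmeas : MeasurableSet {y : ℝ | ‖y‖ ≤ ∑ j, |a j|} :=
    (isClosed_le continuous_norm continuous_const).measurableSet
  rw [hX.ae_iff (p := fun y => ‖y‖ ≤ ∑ j, |a j|) (measurableSet_setOfPred.1 hmeas), symbolLaw,
    ae_finsetSum_measure_iff]
  refine fun j _ => Measure.ae_smul_measure ?_ _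
  rw [ae_dirac_iff hmeas]
  exact Finset.single_le_sum (f := fun j => |a j|) (fun _ _ => abs_nonneg _) (Finset.mem_univ j)

lemma integral_of_hasLaw_symbolLaw {m : ℕ} {a q : Fin (m + 1) → ℝ}
    {θ : Fin m → ℝ} {X : Ω → ℝ} (hX : HasLaw X (symbolLaw a q θ) P) :
    ∫ ω, X ω ∂P = symbolMean a q θ := by
  rw [hX.integral_eq, symbolLaw, integral_finsetSum_measure]
  · refine Finset.sum_congr rfl fun j _ => ?_
    rw [integral_smul_measure, integral_dirac,
      ENNReal.toReal_ofReal (show 0 ≤ symbolProb q θ j from (Real.exp_pos _).le),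
      smul_eq_mul, mul_comm]
  · exact fun j _ => (integrable_dirac (by simp)).smul_measure ENNReal.ofReal_ne_top

variable {N : ℕ}

lemma memLp_of_hasLaw_multivariateGaussian {μ : EuclideanSpace ℝ (Fin N)}
    {V : Matrix (Fin N) (Fin N) ℝ} {W : Ω → EuclideanSpace ℝ (Fin N)}
    (hW : HasLaw W (multivariateGaussian μ V) P) {p : ENNReal} (hp : p ≠ ⊤) : MemLp W p P := by
  have h := IsGaussian.memLp_id (multivariateGaussian μ V) p hp
  rw [← hW.map_eq, memLp_map_measure_iff aestronglyMeasurable_id hW.aemeasurable] at h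
  exact h

lemma variance_inner_of_hasLaw_multivariateGaussian {μ : EuclideanSpace ℝ (Fin N)}
    {V : Matrix (Fin N) (Fin N) ℝ} (hV : V.PosSemidef) {W : Ω → EuclideanSpace ℝ (Fin N)}
    (hW : HasLaw W (multivariateGaussian μ V) P) (u : EuclideanSpace ℝ (Fin N)) :
    Var[fun ω => inner ℝ u (W ω); P] = u ⬝ᵥ V.mulVec u := by
  rw [← covarianceBilin_multivariateGaussian (μ := μ) hV,
    covarianceBilin_self IsGaussian.memLp_two_id, ← hW.map_eq,
    variance_map (by fun_prop) hW.aemeasurable]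
  rfl

/-! ### Covariance matrices and whitening -/

lemma inner_eq_sum_mul (u y : EuclideanSpace ℝ (Fin N)) : inner ℝ u y = ∑ i, u i * y i := by
  simp [PiLp.inner_apply, mul_comm]

lemma variance_inner_eq_covMatrix [IsFiniteMeasure P] {Y : Ω → EuclideanSpace ℝ (Fin N)}
    (hY : ∀ i, MemLp (fun ω => Y ω i) 2 P) (u : EuclideanSpace ℝ (Fin N)) :
    Var[fun ω => inner ℝ u (Y ω); P] = u ⬝ᵥ (covMatrix Y P).mulVec u := by
  simp_rw [inner_eq_sum_mul]
  rw [variance_fun_sum fun i => (hY i).const_mul (u i)]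
  simp only [dotProduct, Matrix.mulVec, Finset.mul_sum, covMatrix, Matrix.of_apply]
  refine Finset.sum_congr rfl fun i _ => Finset.sum_congr rfl fun j _ => ?_
  rw [covariance_const_mul_left, covariance_const_mul_right]
  ring

lemma posDef_covMatrix [IsFiniteMeasure P] {Y : Ω → EuclideanSpace ℝ (Fin N)}
    (hY : ∀ i, MemLp (fun ω => Y ω i) 2 P)
    (h : ∀ u : EuclideanSpace ℝ (Fin N), u ≠ 0 → 0 < Var[fun ω => inner ℝ u (Y ω); P]) :
    (covMatrix Y P).PosDef := by
  refine Matrix.PosDef.of_dotProduct_mulVec_pos ?_ fun v hv => ?_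
  · ext i j
    simp [covMatrix, Matrix.conjTranspose_apply, covariance_comm]
  · have := h (WithLp.toLp 2 v) (by simpa using hv)
    rw [variance_inner_eq_covMatrix hY] at this
    simpa using this

end

section

variable {N : ℕ} {V : Matrix (Fin N) (Fin N) ℝ}

lemma isUnit_det_sqrt (hV : V.PosDef) : IsUnit (CFC.sqrt V).det := by
  rw [← Matrix.isUnit_iff_isUnit_det, CFC.isUnit_sqrt_iff V hV.posSemidef.nonneg]
  exact hV.isUnit

lemma sqrt_isHermitian (V : Matrix (Fin N) (Fin N) ℝ) : (CFC.sqrt V).IsHermitian :=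
  (CFC.sqrt_nonneg V).isSelfAdjoint

lemma inner_toEuclideanCLM_comm {A : Matrix (Fin N) (Fin N) ℝ} (hA : A.IsHermitian)
    (u y : EuclideanSpace ℝ (Fin N)) :
    inner ℝ (Matrix.toEuclideanCLM (𝕜 := ℝ) A u) y
      = inner ℝ u (Matrix.toEuclideanCLM (𝕜 := ℝ) A y) := by
  rw [← ContinuousLinearMap.adjoint_inner_right]
  congr 2
  have h : star (Matrix.toEuclideanCLM (𝕜 := ℝ) A) = Matrix.toEuclideanCLM (𝕜 := ℝ) A := by
    rw [← map_star, Matrix.star_eq_conjTranspose, hA.eq]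
  exact h

/-- Self-adjointness of `V^{-1/2}` moves the whitening from the random vector to the test direction.
-/
lemma inner_whiten (V : Matrix (Fin N) (Fin N) ℝ) (y t : EuclideanSpace ℝ (Fin N)) :
    inner ℝ (whiten V y) t = inner ℝ (whiten V t) y := by
  rw [whiten, inner_toEuclideanCLM_comm (sqrt_isHermitian V).inv, real_inner_comm]
  rfl

lemma sqrt_whiten (hV : V.PosDef) (y : EuclideanSpace ℝ (Fin N)) :
    Matrix.toEuclideanCLM (𝕜 := ℝ) (CFC.sqrt V) (whiten V y) = y := by
  rw [whiten, ← mul_apply_eq_comp, ← map_mul,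
    Matrix.mul_nonsing_inv _ (isUnit_det_sqrt hV), map_one, one_apply_eq_self]

/-- Split `V = √V * √V` and move one root across the inner product; each root cancels a whitening.
-/
lemma whiten_dotProduct_mulVec (hV : V.PosDef) (t : EuclideanSpace ℝ (Fin N)) :
    whiten V t ⬝ᵥ V.mulVec (whiten V t) = ‖t‖ ^ 2 := by
  rw [← Matrix.inner_toEuclideanCLM]
  nth_rw 2 [← CFC.sqrt_mul_sqrt_self V hV.posSemidef.nonneg]
  rw [map_mul, mul_apply_eq_comp, ← inner_toEuclideanCLM_comm (sqrt_isHermitian V),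
    sqrt_whiten hV, real_inner_self_eq_norm_sq]

lemma exists_polyhedron_eq_lowerOrthant (hV : V.PosDef) (e z : EuclideanSpace ℝ (Fin N)) :
    ∃ (b : Fin N → EuclideanSpace ℝ (Fin N)) (c : Fin N → ℝ), (∀ i, ‖b i‖ = 1) ∧
      (fun u => e + Matrix.toEuclideanCLM (𝕜 := ℝ) (CFC.sqrt V) u) ⁻¹' lowerOrthant z
        = polyhedron b c := by
  set R := Matrix.toEuclideanCLM (𝕜 := ℝ) (CFC.sqrt V) with hR
  set r : Fin N → EuclideanSpace ℝ (Fin N) := fun i => R (EuclideanSpace.single i 1) with hr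
  have hcoord : ∀ i u, (R u) i = inner ℝ (r i) u := fun i u => by
    rw [hr, inner_toEuclideanCLM_comm (sqrt_isHermitian V)]
    simp [hR, EuclideanSpace.inner_single_left]
  -- If `r i` vanished, so would the `i`-th coordinate of everything in the range of `R`; but `R`
  -- maps the whitened `i`-th basis vector to that basis vector.
  have hpos : ∀ i, 0 < ‖r i‖ := fun i => by
    refine norm_pos_iff.2 fun h => ?_
    have h1 := hcoord i (whiten V (EuclideanSpace.single i 1))
    rw [hR, sqrt_whiten hV, h] at h1
    simp at h1
  refine ⟨fun i => ‖r i‖⁻¹ • r i, fun i => ‖r i‖⁻¹ * (z i - e i), fun i => ?_, ?_⟩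
  · rw [norm_smul, norm_inv, norm_norm, inv_mul_cancel₀ (hpos i).ne']
  · ext u
    refine forall_congr' fun i => ?_
    rw [real_inner_smul_left, mul_le_mul_iff_right₀ (inv_pos.2 (hpos i)), PiLp.add_apply,
      hcoord, le_sub_iff_add_le']

lemma measurableSet_lowerOrthant (z : EuclideanSpace ℝ (Fin N)) :
    MeasurableSet (lowerOrthant z) := by
  refine IsClosed.measurableSet ?_
  simp only [lowerOrthant, Set.ofPred_forall]
  exact isClosed_iInter fun i => isClosed_le (by fun_prop) (by fun_prop)

/-- The laws of `Y` and of the Gaussian vector with parameters `e`, `V` differ on lower orthants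
by at most a multiple of the Lévy–Prokhorov distance of the whitened laws. -/
lemma abs_measureReal_lowerOrthant_sub_le {Ω : Type*} [MeasurableSpace Ω] {P : Measure Ω}
    [IsProbabilityMeasure P] (hV : V.PosDef) {Y : Ω → EuclideanSpace ℝ (Fin N)}
    {e : EuclideanSpace ℝ (Fin N)} (hm : AEMeasurable (fun ω => whiten V (Y ω - e)) P) {δ : ℝ}
    (hδ : 0 ≤ δ)
    (h : levyProkhorovEDist (P.map fun ω => whiten V (Y ω - e))
      (stdGaussian (EuclideanSpace ℝ (Fin N))) < ENNReal.ofReal δ)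
    (z : EuclideanSpace ℝ (Fin N)) :
    |P.real (Y ⁻¹' lowerOrthant z) - (multivariateGaussian e V).real (lowerOrthant z)|
      ≤ (N + 1) * δ := by
  obtain ⟨b, c, hb, hbc⟩ := exists_polyhedron_eq_lowerOrthant hV e z
  have := Measure.isProbabilityMeasure_map hm
  have h1 := abs_sub_stdGaussian_polyhedron_le hδ h b hb c
  have h2 : P.real (Y ⁻¹' lowerOrthant z)
      = (P.map fun ω => whiten V (Y ω - e)).real (polyhedron b c) := by
    rw [map_measureReal_apply_of_aemeasurable hm (measurableSet_polyhedron b c), ← hbc,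
      ← Set.preimage_comp]
    congr 2
    ext1 ω
    simp [sqrt_whiten hV]
  have h3 : (multivariateGaussian e V).real (lowerOrthant z)
      = (stdGaussian (EuclideanSpace ℝ (Fin N))).real (polyhedron b c) := by
    rw [multivariateGaussian, map_measureReal_apply (by fun_prop) (measurableSet_lowerOrthant z),
      hbc]
  rw [h2, h3]
  simpa using h1

end

/-! ### The hybrid random vector -/

section

variable {N n : ℕ} {Ω : Type*} [MeasurableSpace Ω] {P : Measure Ω}
  {G : Matrix (Fin N) (Fin n) ℝ} {k : Fin n} {S : {k' : Fin n // k' ≠ k} → Ω → ℝ}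
  {W : Ω → EuclideanSpace ℝ (Fin N)}

lemma memLp_hybridVector {p : ENNReal} (hS : ∀ k', MemLp (S k') p P) (hW : MemLp W p P) :
    MemLp (hybridVector G k S W) p P := by
  have h : MemLp (fun ω => ∑ k', S k' ω • column G k'.1) p P :=
    memLp_finsetSum _ fun k' _ => (ContinuousLinearMap.toSpanSingleton ℝ (column G k'.1)).comp_memLp'
      (hS k')
  exact h.add hW

lemma integral_hybridVector (hS : ∀ k', Integrable (S k') P) (hW : Integrable W P) :
    ∫ ω, hybridVector G k S W ω ∂P = (∑ k', (∫ ω, S k' ω ∂P) • column G k'.1) + ∫ ω, W ω ∂P := by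
  simp only [hybridVector]
  rw [integral_add (integrable_finsetSum _ fun k' _ => (hS k').smul_const _) hW,
    integral_finsetSum _ fun k' _ => (hS k').smul_const _]
  simp_rw [integral_smul_const]

lemma indepFun_sum_inner (hSW : IndepFun (fun ω k' => S k' ω) W P) (μ : Fin n → ℝ)
    (e u : EuclideanSpace ℝ (Fin N)) :
    IndepFun (fun ω => ∑ k', inner ℝ u ((S k' ω - μ k'.1) • column G k'.1))
      (fun ω => inner ℝ u (W ω - e)) P := by
  have hφ : Measurable fun s : {k' : Fin n // k' ≠ k} → ℝ =>
      ∑ k', inner ℝ u ((s k' - μ k'.1) • column G k'.1) := by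
    simp_rw [real_inner_smul_right]
    fun_prop
  have hψ : Measurable fun w : EuclideanSpace ℝ (Fin N) => inner ℝ u (w - e) := by fun_prop
  exact hSW.comp hφ hψ

/-- The independent noise alone contributes `σ ^ 2 * ‖u‖ ^ 2`, however degenerate the columns of `G`
are. -/
lemma variance_inner_hybridVector_pos [IsFiniteMeasure P] (hS : ∀ k', MemLp (S k') 2 P) {e : EuclideanSpace ℝ (Fin N)}
    {σ : ℝ} (hσ : 0 < σ)
    (hW : HasLaw W (multivariateGaussian e ((σ ^ 2) • (1 : Matrix (Fin N) (Fin N) ℝ))) P)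
    (hSW : IndepFun (fun ω k' => S k' ω) W P) {u : EuclideanSpace ℝ (Fin N)} (hu : u ≠ 0) :
    0 < Var[fun ω => inner ℝ u (hybridVector G k S W ω); P] := by
  have hW2 : MemLp W 2 P := memLp_of_hasLaw_multivariateGaussian hW (by simp)
  have hind := indepFun_sum_inner (G := G) hSW 0 0 u
  simp only [Pi.zero_apply, sub_zero] at hind
  have hv : Var[fun ω => inner ℝ u (W ω); P] = σ ^ 2 * ‖u‖ ^ 2 := by
    rw [variance_inner_of_hasLaw_multivariateGaussian (Matrix.PosSemidef.one.smul (sq_nonneg σ)) hW,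
      Matrix.smul_mulVec, Matrix.one_mulVec, dotProduct_smul, smul_eq_mul,
      ← real_inner_self_eq_norm_sq, inner_eq_sum_mul]
    rfl
  have hsum : (fun ω => inner ℝ u (hybridVector G k S W ω))
      = fun ω => ∑ k', inner ℝ u (S k' ω • column G k'.1) + inner ℝ u (W ω) := by
    ext ω
    rw [hybridVector, inner_add_right, inner_sum]
  rw [hsum, hind.variance_fun_add _ (hW2.const_inner u), hv]
  · have := variance_nonneg (fun ω => ∑ k', inner ℝ u (S k' ω • column G k'.1)) P
    have := norm_pos_iff.2 hu
    positivity
  · refine memLp_finsetSum _ fun k' _ => ?_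
    simp_rw [real_inner_smul_right]
    exact (hS k').mul_const _

lemma posDef_covMatrix_hybridVector [IsFiniteMeasure P] (hS : ∀ k', MemLp (S k') 2 P)
    {e : EuclideanSpace ℝ (Fin N)} {σ : ℝ} (hσ : 0 < σ)
    (hW : HasLaw W (multivariateGaussian e ((σ ^ 2) • (1 : Matrix (Fin N) (Fin N) ℝ))) P)
    (hSW : IndepFun (fun ω k' => S k' ω) W P) :
    (covMatrix (hybridVector G k S W) P).PosDef := by
  have hY := memLp_hybridVector (G := G) hS (memLp_of_hasLaw_multivariateGaussian hW (by simp))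
  refine posDef_covMatrix (fun i => ?_) fun u hu =>
    variance_inner_hybridVector_pos hS hσ hW hSW hu
  exact (EuclideanSpace.proj (𝕜 := ℝ) i).comp_memLp' hY

/-- The characteristic function of the whitened hybrid random vector is close to that of the
standard Gaussian vector as soon as the third moments are small. -/
lemma norm_charFun_whiten_sub_le [IsProbabilityMeasure P] {μ : Fin n → ℝ} {x σ : ℝ} (hσ : 0 < σ)
    (hS : ∀ k', MemLp (S k') 3 P) (hμ : ∀ k', ∫ ω, S k' ω ∂P = μ k'.1)
    (hW : HasLaw W (multivariateGaussian (x • column G k)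
      ((σ ^ 2) • (1 : Matrix (Fin N) (Fin N) ℝ))) P)
    (hSind : iIndepFun S P) (hSW : IndepFun (fun ω k' => S k' ω) W P)
    (t : EuclideanSpace ℝ (Fin N)) :
    ‖charFun (P.map fun ω => whiten (covMatrix (hybridVector G k S W) P)
          (hybridVector G k S W ω - ∫ ω, hybridVector G k S W ω ∂P)) t
        - charFun (stdGaussian (EuclideanSpace ℝ (Fin N))) t‖
      ≤ 5 * ‖t‖ ^ 3 * thirdMomentSum P G k x μ S W := by
  have hle : (2 : ENNReal) ≤ 3 := by norm_num
  have hS2 := fun k' => (hS k').mono_exponent hle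
  have hS1 := fun k' => (hS k').integrable (by norm_num)
  have hW3 : MemLp W 3 P := memLp_of_hasLaw_multivariateGaussian hW (by simp)
  have hW1 : Integrable W P := hW3.integrable (by norm_num)
  have hWm : ∫ ω, W ω ∂P = x • column G k := by
    rw [hW.integral_eq, integral_id_multivariateGaussian]
  have hY3 := memLp_hybridVector (G := G) hS hW3
  have hV := posDef_covMatrix_hybridVector (G := G) hS2 hσ hW hSW
  simp only [thirdMomentSum]
  set Y := hybridVector G k S W with hYdef
  set V := covMatrix Y P with hVdef
  set u := whiten V t with hu
  have hE : ∫ ω, Y ω ∂P = (∑ k' : {k' : Fin n // k' ≠ k}, μ k'.1 • column G k'.1) + x • column G k := by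
    rw [hYdef, integral_hybridVector hS1 hW1, hWm]
    simp_rw [hμ]
  set X : {k' : Fin n // k' ≠ k} → Ω → ℝ :=
    fun k' ω => inner ℝ u ((S k' ω - μ k'.1) • column G k'.1) with hX
  set Z : Ω → ℝ := fun ω => inner ℝ u (W ω - x • column G k) with hZ
  have hsum : ∀ ω, inner ℝ u (Y ω - ∫ ω, Y ω ∂P) = ∑ k', X k' ω + Z ω := fun ω => by
    rw [hE, hX, hZ, ← inner_sum, ← inner_add_right]
    congr 1
    simp only [hYdef, hybridVector, sub_smul, Finset.sum_sub_distrib]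
    abel
  have hX3 : ∀ k', MemLp (X k') 3 P := fun k' => by
    simp only [hX, real_inner_smul_right]
    exact ((hS k').sub (memLp_const _)).mul_const _
  have hX0 : ∀ k', ∫ ω, X k' ω ∂P = 0 := fun k' => by
    simp only [hX, real_inner_smul_right]
    rw [integral_mul_const, integral_sub (hS1 k') (integrable_const _), hμ]
    simp
  have hZ3 : MemLp Z 3 P := (hW3.sub (memLp_const _)).const_inner u
  have hZ0 : ∫ ω, Z ω ∂P = 0 := by
    have h1 : Integrable (fun ω => W ω - x • column G k) P := hW1.sub (integrable_const _)
    rw [integral_inner h1, integral_sub hW1 (integrable_const _), hWm]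
    simp
  have hXind : iIndepFun X P :=
    hSind.comp (fun k' s => inner ℝ u ((s - μ k'.1) • column G k'.1)) fun k' => by fun_prop
  have hXZ : IndepFun (fun ω => ∑ k', X k' ω) Z P := indepFun_sum_inner hSW μ _ u
  have hmain := norm_charFun_sum_add_sub_exp_le hX3 hX0 hXind hZ3 hZ0 hXZ
  have hvar : Var[fun ω => ∑ k', X k' ω + Z ω; P] = ‖t‖ ^ 2 := by
    simp_rw [← hsum, inner_sub_right]
    rw [variance_sub_const (hY3.const_inner u).aestronglyMeasurable,
      variance_inner_eq_covMatrix fun i =>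
        (EuclideanSpace.proj (𝕜 := ℝ) i).comp_memLp' (hY3.mono_exponent hle)]
    exact whiten_dotProduct_mulVec hV t
  have hYm : AEMeasurable (fun ω => whiten V (Y ω - ∫ ω, Y ω ∂P)) P :=
    (Matrix.toEuclideanCLM (𝕜 := ℝ) (CFC.sqrt V)⁻¹).continuous.measurable.comp_aemeasurable
      (hY3.aestronglyMeasurable.aemeasurable.sub_const _)
  have hXZm : AEMeasurable (fun ω => ∑ k', X k' ω + Z ω) P :=
    (Finset.aemeasurable_fun_sum _ fun k' _ =>
      (hX3 k').aestronglyMeasurable.aemeasurable).add hZ3.aestronglyMeasurable.aemeasurable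
  -- Cramér–Wold reduction: the frequency `t` is carried by the direction `u`, leaving a real
  -- variable at frequency `1`.
  have hcf : charFun (P.map fun ω => whiten V (Y ω - ∫ ω, Y ω ∂P)) t
      = charFun (P.map fun ω => ∑ k', X k' ω + Z ω) 1 := by
    rw [charFun_apply, integral_map hYm (by fun_prop), charFun_apply_real,
      integral_map hXZm (by fun_prop)]
    refine integral_congr_ae (ae_of_all _ fun ω => ?_)
    simp only [inner_whiten, ← hu, hsum]
    simp
  rw [hcf, charFun_stdGaussian]
  rw [hvar] at hmain
  push_cast at hmain
  refine hmain.trans ?_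
  rw [mul_assoc]
  refine mul_le_mul_of_nonneg_left ?_ (by norm_num)
  -- The whitening is moved back from `t` to `F`, and Cauchy–Schwarz then separates the factor `‖t‖
  -- ^ 3`.
  have hbound : ∀ (F : Ω → EuclideanSpace ℝ (Fin N)), MemLp F 3 P →
      ∫ ω, |inner ℝ u (F ω)| ^ 3 ∂P ≤ ‖t‖ ^ 3 * ∫ ω, ‖whiten V (F ω)‖ ^ 3 ∂P := fun F hF => by
    have hwF : MemLp (fun ω => whiten V (F ω)) 3 P :=
      (Matrix.toEuclideanCLM (𝕜 := ℝ) (CFC.sqrt V)⁻¹).comp_memLp' hF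
    rw [← integral_const_mul]
    refine integral_mono (integrable_abs_pow_three (hF.const_inner u))
      ((hwF.integrable_norm_pow (p := 3) (by norm_num)).const_mul _) fun ω => ?_
    simp only
    rw [hu, ← inner_whiten, ← mul_pow, mul_comm]
    exact pow_le_pow_left₀ (abs_nonneg _) (abs_real_inner_le_norm _ _) 3
  rw [mul_add, Finset.mul_sum]
  refine add_le_add (Finset.sum_le_sum fun k' _ => hbound _ ?_) (hbound _ ?_)
  · exact (ContinuousLinearMap.toSpanSingleton ℝ (column G k'.1)).comp_memLp'
      ((hS k').sub (memLp_const _))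
  · exact hW3.sub (memLp_const _)

end

end HybridCLT

/-! ### Convergence in distribution and uniform convergence of distribution functions -/

theorem theorem1 {N m : ℕ}
    -- the alphabet, the priors and the parameters of the symbols
    (a : Fin (m + 1) → ℝ)
    (q : ∀ K : ℕ+, Fin (2 * (K : ℕ)) → Fin (m + 1) → ℝ)
    (hq_pos : ∀ K k' j, 0 < q K k' j) (hq_sum : ∀ K k', ∑ j, q K k' j = 1)
    (θ : ∀ K : ℕ+, Fin (2 * (K : ℕ)) → Fin m → ℝ)
    -- the matrix with columns `g_{k'}`, the distinguished index `k`, the known symbol `x = s_k`,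
    -- and the standard deviation of the noise
    (G : ∀ K : ℕ+, Matrix (Fin N) (Fin (2 * (K : ℕ))) ℝ)
    (k : ∀ K : ℕ+, Fin (2 * (K : ℕ))) (x : ℕ+ → ℝ)
    (σ : ℕ+ → ℝ) (hσ : ∀ K, 0 < σ K)
    -- for every `K`, independent symbols and an independent Gaussian vector
    {Ω : ℕ+ → Type*} [∀ K, MeasurableSpace (Ω K)]
    (P : ∀ K, Measure (Ω K)) [∀ K, IsProbabilityMeasure (P K)]
    (S : ∀ K : ℕ+, {k' : Fin (2 * (K : ℕ)) // k' ≠ k K} → Ω K → ℝ)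
    (W : ∀ K, Ω K → EuclideanSpace ℝ (Fin N))
    (hS_law : ∀ (K : ℕ+) k', HasLaw (S K k') (HybridCLT.symbolLaw a (q K k'.1) (θ K k'.1)) (P K))
    (hW_law : ∀ K, HasLaw (W K)
      (multivariateGaussian (x K • HybridCLT.column (G K) (k K))
        ((σ K ^ 2) • (1 : Matrix (Fin N) (Fin N) ℝ))) (P K))
    (hS_indep : ∀ K : ℕ+, iIndepFun (S K) (P K))
    (hSW_indep : ∀ K : ℕ+, IndepFun (fun ω k' => S K k' ω) (W K) (P K))
    -- the third-moment condition
    (hthird : Tendsto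
      (fun K => HybridCLT.thirdMomentSum (P K) (G K) (k K) (x K)
        (fun k' => HybridCLT.symbolMean a (q K k') (θ K k')) (S K) (W K))
      atTop (𝓝 0)) :
    let Y : ∀ K, Ω K → EuclideanSpace ℝ (Fin N) :=
      fun K => HybridCLT.hybridVector (G K) (k K) (S K) (W K)
    let E : ℕ+ → EuclideanSpace ℝ (Fin N) := fun K => ∫ ω, Y K ω ∂(P K)
    let V : ℕ+ → Matrix (Fin N) (Fin N) ℝ := fun K => HybridCLT.covMatrix (Y K) (P K)
    -- `V^{-1/2} (Y - E)` converges in distribution to the standard Gaussian vector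
    TendstoInDistribution (fun K ω => HybridCLT.whiten (V K) (Y K ω - E K)) atTop
        (id : EuclideanSpace ℝ (Fin N) → EuclideanSpace ℝ (Fin N)) P
        (multivariateGaussian 0 (1 : Matrix (Fin N) (Fin N) ℝ)) ∧
    -- the distribution functions of `Y` and of `N(E, V)` approach each other uniformly
    TendstoUniformly
        (fun K z => (P K).real (Y K ⁻¹' HybridCLT.lowerOrthant z)
          - (multivariateGaussian (E K) (V K)).real (HybridCLT.lowerOrthant z))
        (fun _ => (0 : ℝ)) atTop := by
  intro Y E V
  have hS3 : ∀ (K : ℕ+) k', MemLp (S K k') 3 (P K) := fun K k' =>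
    HybridCLT.memLp_of_hasLaw_symbolLaw (hS_law K k') 3
  have hS2 : ∀ (K : ℕ+) k', MemLp (S K k') 2 (P K) := fun K k' =>
    HybridCLT.memLp_of_hasLaw_symbolLaw (hS_law K k') 2
  have hV : ∀ K, (V K).PosDef := fun K =>
    HybridCLT.posDef_covMatrix_hybridVector (hS2 K) (hσ K) (hW_law K) (hSW_indep K)
  have hZm : ∀ K, AEMeasurable (fun ω => HybridCLT.whiten (V K) (Y K ω - E K)) (P K) := fun K =>
    (Matrix.toEuclideanCLM (𝕜 := ℝ) (CFC.sqrt (V K))⁻¹).continuous.measurable.comp_aemeasurable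
      ((HybridCLT.memLp_hybridVector (hS2 K) (HybridCLT.memLp_of_hasLaw_multivariateGaussian
        (hW_law K) (by simp))).aestronglyMeasurable.aemeasurable.sub_const _)
  have hcf : ∀ t, Tendsto
      (fun K => charFun ((P K).map fun ω => HybridCLT.whiten (V K) (Y K ω - E K)) t) atTop
      (𝓝 (charFun (stdGaussian (EuclideanSpace ℝ (Fin N))) t)) := fun t => by
    rw [tendsto_iff_norm_sub_tendsto_zero]
    refine squeeze_zero (fun _ => norm_nonneg _) (fun K => ?_)
      (by simpa using hthird.const_mul (5 * ‖t‖ ^ 3))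
    exact HybridCLT.norm_charFun_whiten_sub_le (hσ K) (hS3 K)
      (fun k' => HybridCLT.integral_of_hasLaw_symbolLaw (hS_law K k')) (hW_law K) (hS_indep K)
      (hSW_indep K) t
  have hdist : TendstoInDistribution (fun K ω => HybridCLT.whiten (V K) (Y K ω - E K)) atTop
      (id : EuclideanSpace ℝ (Fin N) → EuclideanSpace ℝ (Fin N)) P
      (multivariateGaussian 0 (1 : Matrix (Fin N) (Fin N) ℝ)) := by
    -- Lévy's continuity theorem is applied along arbitrary sequences `φ : ℕ → ℕ+` tending to
    -- infinity, which is enough because `atTop` is countably generated.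
    refine ⟨hZm, aemeasurable_id, tendsto_of_seq_tendsto fun φ hφ => ?_⟩
    refine ProbabilityMeasure.tendsto_iff_tendsto_charFun.2 fun t => ?_
    simpa using! (hcf t).comp hφ
  refine ⟨hdist, ?_⟩
  have hLP := HybridCLT.tendsto_levyProkhorovEDist hdist.tendsto
  rw [Metric.tendstoUniformly_iff]
  intro ε hε
  have hN : (0 : ℝ) < N + 1 := by positivity
  -- With this radius the bound `(N + 1) * δ` equals `ε / 2`, for all `z` simultaneously.
  have hδ : 0 < ε / (2 * (N + 1)) := by positivity
  filter_upwards [hLP.eventually_lt_const (ENNReal.ofReal_pos.2 hδ)] with K hK z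
  have hK' : levyProkhorovEDist ((P K).map fun ω => HybridCLT.whiten (V K) (Y K ω - E K))
      (stdGaussian (EuclideanSpace ℝ (Fin N))) < ENNReal.ofReal (ε / (2 * (N + 1))) := by
    simpa using! hK
  have h := HybridCLT.abs_measureReal_lowerOrthant_sub_le (hV K) (hZm K) hδ.le hK' z
  rw [dist_comm, Real.dist_eq, sub_zero]
  refine h.trans_lt ?_
  rw [show (N + 1 : ℝ) * (ε / (2 * (N + 1))) = ε / 2 by field_simp]
  exact half_lt_self hε
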